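/- Let $m,N\in\mathbb N$ and $\mathbb R_+=[0,+\infty)$. Let $H_1,\dots,H_m:\mathbb R^N\times\mathbb R^N\to\mathbb R$ be such that, for every $i$: $H_i$ is uniformly continuous on $\mathbb R^N\times B_R$ for every $R>0$, where $B_R$ is the open ball of radius $R$ centered at $0$; $p\mapsto H_i(x,p)$ is convex for every $x$; and there are superlinear functions $\alpha,\beta:\mathbb R_+\to\mathbb R$ (that is, $\alpha(h)/h\to+\infty$ and $\beta(h)/h\to+\infty$ as $h\to+\infty$) with $\alpha(|p|)\le H_i(x,p)\le\beta(|p|)$ for all $x,p\in\mathbb R^N$. Let $L_i(x,q)=\sup_{p\in\mathbb R^N}\{\langle p,q\rangle-H_i(x,p)\}$. Let $B=(b_{ij})$ be a real $m\times m$ matrix with $b_{ij}\le 0$ for $j\ne i$ and $\sum_j b_{ij}=0$ for every $i$. Let $\Omega$ be the space of càdlàg paths $\omega:\mathbb R_+\to\{1,\dots,m\}$ with the $\sigma$-algebra generated by the evaluations $\omega\mapsto\omega(t)$, and let $\mathbb P$ be a probability measure on $\Omega$ under which $(\omega(t))_{t\ge0}$ is a Markov chain with generator matrix $-B$, i.e.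 $$\mathbb P\big(\omega(t_k)=i_k\,|\,\omega(t_1)=i_1,\dots,\omega(t_{k-1})=i_{k-1}\big)=\big(e^{-B(t_k-t_{k-1})}\big)_{i_{k-1}i_k}$$ for all $k\ge2$, $0\le t_1<\dots<t_k$ and states $i_1,\dots,i_k$ for which the conditioning event has positive probability. Assume $\mathbb P(\omega(0)=i)>0$ for every $i$, and let $\mathbb E_i$ be the expectation with respect to $\mathbb P$ conditioned to $\{\omega(0)=i\}$. Let $\mathbf u=(u_1,\dots,u_m):\mathbb R_+\times\mathbb R^N\to\mathbb R^m$ be locally bounded from above (no continuity is assumed) and satisfy the sub-optimality principle: $$u_i\big(t_0+h,\gamma(0)\big)-\mathbb E_i\big[u_{\omega(h)}\big(t_0,\gamma(h)\big)\big]\le\mathbb E_i\Big[\int_0^hL_{\omega(s)}\big(\gamma(s),-\dot\gamma(s)\big)\,ds\Big]$$ for all $t_0,h\ge0$, all $i\in\{1,\dots,m\}$ and all deterministic locally absolutely continuous curves $\gamma:\mathbb R_+\to\mathbb R^N$ (the right-hand side is in $(-\infty,+\infty]$). Then $\mathbf u$ is a viscosity subsolution, in the discontinuous sense, of $$\partial_tu_i+H_i(x,D_xu_i)+\big(B\mathbf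 u(t,x)\big)_i=0\quad\text{in }(0,+\infty)\times\mathbb R^N,\qquad i\in\{1,\dots,m\}.\tag{HJS}$$ That is, let $u_i^*(t,x)=\limsup_{(s,y)\to(t,x)}u_i(s,y)$ be the upper semicontinuous envelope, the point $(t,x)$ being admitted among the $(s,y)$. Then, for every $(t,x)\in(0,+\infty)\times\mathbb R^N$, every $i$, and every function $\phi$ of class $C^1$ near $(t,x)$ such that $u_i^*-\phi$ has a local maximum at $(t,x)$, $$\partial_t\phi(t,x)+H_i\big(x,D_x\phi(t,x)\big)+\big(B\mathbf u^*(t,x)\big)_i\le0.$$ -/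

import Mathlib

open MeasureTheory Filter Topology Set
open scoped NNReal ENNReal RealInnerProductSpace

noncomputable section

namespace HJSystem

/-- The space `ℝ^N` with its Euclidean structure. -/
abbrev Space (N : ℕ) := EuclideanSpace ℝ (Fin N)

/-! ### The system: Hamiltonians, Lagrangians, coupling matrix -/

/-- Superlinearity of a real function on `[0, ∞)`. -/
def Superlinear (α : ℝ → ℝ) : Prop := Tendsto (fun h : ℝ => α h / h) atTop atTop

/-- The standing assumptions on a Hamiltonian `H : ℝ^N × ℝ^N → ℝ`: uniform continuity on
`ℝ^N × B_R` for every `R > 0`, convexity in the momentum, and two superlinear bounds, uniform in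
the position. -/
structure IsHamiltonian {N : ℕ} (H : Space N → Space N → ℝ) : Prop where
  uniformContinuousOn : ∀ R : ℝ, 0 < R →
    UniformContinuousOn (fun z : Space N × Space N => H z.1 z.2) (univ ×ˢ Metric.ball 0 R)
  convex : ∀ x, ConvexOn ℝ univ (H x)
  superlinear : ∃ α β : ℝ → ℝ, Superlinear α ∧ Superlinear β ∧
    ∀ x p, α ‖p‖ ≤ H x p ∧ H x p ≤ β ‖p‖

/-- The Lagrangian: the Fenchel transform of the Hamiltonian in the momentum.  Under
`IsHamiltonian` the supremum is over a set bounded above, hence it is a genuine supremum. -/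
def lagrangian {N : ℕ} (H : Space N → Space N → ℝ) (x q : Space N) : ℝ :=
  ⨆ p : Space N, (⟪p, q⟫ - H x p)

/-- The assumption on the coupling matrix: nonpositive off-diagonal entries, rows summing to `0`. -/
structure IsCouplingMatrix {m : ℕ} (B : Matrix (Fin m) (Fin m) ℝ) : Prop where
  offDiag_nonpos : ∀ i j, j ≠ i → B i j ≤ 0
  row_sum : ∀ i, ∑ j, B i j = 0

/-! ### Viscosity subsolutions, in the discontinuous sense -/

/-- `u` is locally bounded from above (componentwise) on `ℝ_+ × ℝ^N`. -/
def LocallyBoundedAbove {m N : ℕ} (u : ℝ≥0 × Space N → Fin m → ℝ) : Prop :=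
  ∀ z, ∃ C : ℝ, ∀ᶠ w in 𝓝 z, ∀ i, u w i ≤ C

/-- The upper semicontinuous envelope, `u_i^*(z) = limsup_{w → z} u_i(w)`; the point `z` itself is
among the competitors `w`. -/
def uscEnvelope {m N : ℕ} (u : ℝ≥0 × Space N → Fin m → ℝ) (z : ℝ≥0 × Space N) (i : Fin m) : ℝ :=
  limsup (fun w => u w i) (𝓝 z)

/-- The superdifferential `D⁺ v(t, x)`: the pairs `(p_t, p_x)` that are time derivative and spatial
gradient at `(t, x)` of a function `φ`, of class `C¹` near `(t, x)`, such that `v - φ` has a local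
maximum at `(t, x)`.  It is used only at points with `t > 0`. -/
def superdifferential {N : ℕ} (v : ℝ≥0 × Space N → ℝ) (z : ℝ≥0 × Space N) : Set (ℝ × Space N) :=
  {p | ∃ φ : ℝ × Space N → ℝ,
    ContDiffAt ℝ 1 φ ((z.1 : ℝ), z.2) ∧
    IsLocalMax (fun w : ℝ≥0 × Space N => v w - φ ((w.1 : ℝ), w.2)) z ∧
    ∀ (τ : ℝ) (y : Space N), fderiv ℝ φ ((z.1 : ℝ), z.2) (τ, y) = p.1 * τ + ⟪p.2, y⟫}

/-- `u` is a viscosity subsolution in `(0, ∞) × ℝ^N` of the system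
`∂_t u_i + H_i(x, D_x u_i) + (B u(t, x))_i = 0`, `i = 1, …, m`. -/
structure IsViscositySubsolution {m N : ℕ} (H : Fin m → Space N → Space N → ℝ)
    (B : Matrix (Fin m) (Fin m) ℝ) (u : ℝ≥0 × Space N → Fin m → ℝ) : Prop where
  locallyBoundedAbove : ∀ z : ℝ≥0 × Space N, 0 < z.1 → ∃ C : ℝ, ∀ᶠ w in 𝓝 z, ∀ i, u w i ≤ C
  subsolution : ∀ z : ℝ≥0 × Space N, 0 < z.1 → ∀ i : Fin m,
    ∀ p ∈ superdifferential (fun w => uscEnvelope u w i) z,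
      p.1 + H i z.2 p.2 + (B.mulVec (uscEnvelope u z)) i ≤ 0

/-! ### The random frame -/

/-- The sample space: càdlàg paths `ℝ_+ → {1, …, m}`. -/
def PathSpace (m : ℕ) :=
  {ω : ℝ≥0 → Fin m // ∀ t, ContinuousWithinAt ω (Ici t) t ∧ ∃ l, Tendsto ω (𝓝[<] t) (𝓝 l)}

instance (m : ℕ) : CoeFun (PathSpace m) (fun _ => ℝ≥0 → Fin m) := ⟨Subtype.val⟩

/-- The `σ`-algebra on the path space generated by the evaluation maps `ω ↦ ω(t)`, that is, by the
cylinders. -/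
instance (m : ℕ) : MeasurableSpace (PathSpace m) :=
  ⨆ t : ℝ≥0, MeasurableSpace.comap (fun ω : PathSpace m => ω t) ⊤

/-- The event `Ω_i` of the paths that start in the state `i`. -/
def startsAt {m : ℕ} (i : Fin m) : Set (PathSpace m) := {ω | ω 0 = i}

/-- Under the measure `P` the evaluation process is a continuous-time Markov chain with generator
matrix `-B`:
`P(ω(t_k) = i_k | ω(t_1) = i_1, …, ω(t_{k-1}) = i_{k-1}) = (e^{-B (t_k - t_{k-1})})_{i_{k-1} i_k}`
for all `0 ≤ t_1 < … < t_k`, `k ≥ 2`, and all states such that the conditioning event has positive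
probability. -/
def IsMarkovChain {m : ℕ} (B : Matrix (Fin m) (Fin m) ℝ) (P : Measure (PathSpace m)) : Prop :=
  ∀ (n : ℕ) (t : Fin (n + 2) → ℝ≥0) (s : Fin (n + 2) → Fin m), StrictMono t →
    P {ω | ∀ k : Fin (n + 1), ω (t k.castSucc) = s k.castSucc} ≠ 0 →
    ProbabilityTheory.cond P {ω | ∀ k : Fin (n + 1), ω (t k.castSucc) = s k.castSucc}
        {ω | ω (t (Fin.last (n + 1))) = s (Fin.last (n + 1))} =
      ENNReal.ofReal (NormedSpace.exp
        (-(((t (Fin.last (n + 1)) : ℝ) - t (Fin.last n).castSucc) • B))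
          (s (Fin.last n).castSucc) (s (Fin.last (n + 1))))

/-- The probability measure `P_i`: `P` conditioned to the event `Ω_i`. -/
def condStart {m : ℕ} (P : Measure (PathSpace m)) (i : Fin m) : Measure (PathSpace m) :=
  ProbabilityTheory.cond P (startsAt i)

/-! ### The sub-optimality principle -/

/-- The integral of an extended-real-valued function, as the integral of its positive part minus
the integral of its negative part.  It is used only for functions bounded from below on spaces of
finite measure, so that it is an element of `(-∞, +∞]`. -/
def extIntegral {α : Type*} [MeasurableSpace α] (μ : Measure α) (f : α → EReal) : EReal :=
  ((∫⁻ a, (f a).toENNReal ∂μ : ℝ≥0∞) : EReal) - ((∫⁻ a, (-f a).toENNReal ∂μ : ℝ≥0∞) : EReal)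

/-- A (deterministic) curve: a locally absolutely continuous map `[0, ∞) → ℝ^N`.  The values at
negative times are irrelevant. -/
def IsCurve {N : ℕ} (γ : ℝ → Space N) : Prop :=
  ∀ T : ℝ, 0 ≤ T → AbsolutelyContinuousOnInterval γ 0 T

/-- The random action `∫_0^h L_{ω(s)}(γ(s), -γ'(s)) ds ∈ (-∞, +∞]` of a curve along the path `ω`. -/
def pathAction {m N : ℕ} (H : Fin m → Space N → Space N → ℝ) (γ : ℝ → Space N) (h : ℝ≥0)
    (ω : PathSpace m) : EReal :=
  extIntegral (volume.restrict (Icc (0 : ℝ) h))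
    (fun s : ℝ => ((lagrangian (H (ω s.toNNReal)) (γ s) (-deriv γ s) : ℝ) : EReal))

/-- The sub-optimality principle:
`u_i(t₀ + h, γ(0)) - E_i[u_{ω(h)}(t₀, γ(h))] ≤ E_i[∫_0^h L_{ω(s)}(γ(s), -γ'(s)) ds]`
for all `t₀, h ≥ 0`, all indices `i` and all curves `γ`; the right-hand side may be `+∞`. -/
def SubOptimalityPrinciple {m N : ℕ} (H : Fin m → Space N → Space N → ℝ)
    (P : Measure (PathSpace m)) (u : ℝ≥0 × Space N → Fin m → ℝ) : Prop :=
  ∀ (t₀ h : ℝ≥0) (i : Fin m) (γ : ℝ → Space N), IsCurve γ →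
    ((u (t₀ + h, γ 0) i - ∫ ω, u (t₀, γ h) (ω h) ∂(condStart P i) : ℝ) : EReal) ≤
      extIntegral (condStart P i) (pathAction H γ h)

end HJSystem

end

/-!
The sub-optimality principle is tested on short straight lines `γ(s) = y - s q`, for which it
reads
`u_i(t', y) - ∑_j w_j(h) u_j(t' - h, y - h q) ≤ E_i[∫_0^h L_{ω(s)}(γ(s), q) ds]`,
where `w_j(h)` is the probability of being in `j` at time `h` when starting from `i`.

The right-hand side is at most `h ((L_i(x, q) + η) π(h) + M (1 - π(h)))` for `y` near `x` and `h`
small, where `π(h)` is the probability of no jump before `h`.  This uses that the Lagrangians are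
upper semicontinuous in the position (`IsHamiltonian.eventually_lagrangian_le`, from superlinearity
and uniform continuity) and `extIntegral_pathAction_le`.  Since paths are right continuous with
values in a discrete space, `π(h) → 1` as `h → 0` (`tendsto_condStart_staysUntil`).

This bound is uniform in the base point, so the principle passes to the envelope `u^*` by letting
`(t', y) → (t, x)` along a sequence realizing `u_i^*(t, x)`, with `h` fixed
(`SubOptimalityPrinciple.uscEnvelope_sub_sum_le`).  Then the inequality is divided by `h`, and
`h → 0`: as `(δ_ij - w_j(h)) / h → B_ij` (`IsCouplingMatrix.tendsto_transitionProb`), the weights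
produce the coupling term, and the test function touching `u_i^*` from above produces
`p_t + ⟨p_x, q⟩`.  The outcome is `p_t + ⟨p_x, q⟩ + (B u^*)_i ≤ L_i(x, q)` for every `q`.  When `q`
is a subgradient of the convex function `H_i(x, ·)` at `p_x`, which exists by Hahn–Banach,
`⟨p_x, q⟩ - L_i(x, q) ≥ H_i(x, p_x)`, and this is the subsolution inequality.
-/

namespace HJSystem

/-! ### The Lagrangian -/

/-- A finite convex function on `ℝ^N` has a subgradient at each point: separate the point
`(p₀, f p₀)` from the strict epigraph of `f`, which is open because `f` is continuous. -/
lemma exists_subgradient {N : ℕ} {f : Space N → ℝ} (hf : ConvexOn ℝ univ f) (p₀ : Space N) :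
    ∃ q : Space N, ∀ p, f p₀ + ⟪p - p₀, q⟫ ≤ f p := by
  have hcont : Continuous f :=
    continuousOn_univ.1 (hf.continuousOn isOpen_univ)
  have hopen : IsOpen {z : Space N × ℝ | z.1 ∈ univ ∧ f z.1 < z.2} := by
    simpa using isOpen_lt (hcont.comp continuous_fst) continuous_snd
  obtain ⟨g, hg⟩ := geometric_hahn_banach_open_point (x := (p₀, f p₀))
    hf.convex_strict_epigraph hopen (by simp)
  have hsplit : ∀ (p : Space N) (r : ℝ), g (p, r) = g (p, 0) + r * g (0, 1) := by
    intro p r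
    have : ((p, r) : Space N × ℝ) = (p, 0) + r • (0, 1) := by simp
    rw [this, map_add, map_smul, smul_eq_mul]
  have hc : g (0, 1) < 0 := by
    have := hg (p₀, f p₀ + 1) (by simp)
    rw [hsplit p₀ (f p₀ + 1), hsplit p₀ (f p₀)] at this
    linarith
  set c := -g (0, 1) with hc_def
  have hcpos : 0 < c := by linarith
  set l : Space N →L[ℝ] ℝ := g.comp (ContinuousLinearMap.inl ℝ (Space N) ℝ) with hl
  have hlg : ∀ p, l p = g (p, 0) := fun p => by simp [hl]
  refine ⟨c⁻¹ • (InnerProductSpace.toDual ℝ (Space N)).symm l, fun p => ?_⟩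
  have hinner : ⟪p - p₀, c⁻¹ • (InnerProductSpace.toDual ℝ (Space N)).symm l⟫
      = c⁻¹ * (l p - l p₀) := by
    rw [real_inner_comm, real_inner_smul_left, InnerProductSpace.toDual_symm_apply, map_sub]
  rw [hinner]
  refine le_of_forall_pos_le_add fun ε hε => ?_
  have := hg (p, f p + ε) (by simpa using hε)
  rw [hsplit p, hsplit p₀, ← hlg, ← hlg] at this
  have h2 : l p - l p₀ ≤ c * (f p + ε - f p₀) := by
    rw [hc_def]; linarith
  have h3 : c⁻¹ * (l p - l p₀) ≤ f p + ε - f p₀ := by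
    rw [inv_mul_le_iff₀ hcpos]; exact h2
  linarith

/-- Superlinearity makes the supremum defining the Lagrangian local in the momentum: outside a
large ball, the competitors lie below any prescribed level, uniformly in the position. -/
lemma IsHamiltonian.exists_radius {N : ℕ} {H : Space N → Space N → ℝ} (hH : IsHamiltonian H)
    (q : Space N) (a : ℝ) :
    ∃ R : ℝ, 0 < R ∧ ∀ y p : Space N, R ≤ ‖p‖ → ⟪p, q⟫ - H y p ≤ a := by
  obtain ⟨α, β, hα, -, hαH⟩ := hH.superlinear
  obtain ⟨R₀, hR₀⟩ := eventually_atTop.1 (hα.eventually_ge_atTop (‖q‖ + 1))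
  refine ⟨max (max R₀ (-a)) 1, by positivity, fun y p hp => ?_⟩
  have h1 : 1 ≤ ‖p‖ := (le_max_right _ _).trans hp
  have h2 : -a ≤ ‖p‖ := ((le_max_right _ _).trans (le_max_left _ _)).trans hp
  have h3 := hR₀ ‖p‖ (((le_max_left _ _).trans (le_max_left _ _)).trans hp)
  rw [le_div_iff₀ (by linarith)] at h3
  have h4 := (hαH y p).1
  have h5 := real_inner_le_norm p q
  nlinarith

lemma IsHamiltonian.bddAbove {N : ℕ} {H : Space N → Space N → ℝ} (hH : IsHamiltonian H)
    (x q : Space N) : BddAbove (range fun p : Space N => ⟪p, q⟫ - H x p) := by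
  obtain ⟨R, -, hR⟩ := hH.exists_radius q 0
  have hcont : Continuous fun p : Space N => ⟪p, q⟫ - H x p :=
    (by fun_prop : Continuous fun p : Space N => ⟪p, q⟫).sub
      (continuousOn_univ.1 ((hH.convex x).continuousOn isOpen_univ))
  obtain ⟨C, hC⟩ := (isCompact_closedBall (0 : Space N) R).bddAbove_image hcont.continuousOn
  refine ⟨max C 0, ?_⟩
  rintro _ ⟨p, rfl⟩
  rcases le_total ‖p‖ R with h | h
  · exact le_max_of_le_left (hC (mem_image_of_mem _ (by simpa using h)))
  · exact le_max_of_le_right (hR x p h)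

/-- The inequality of Fenchel duality that the proof needs: it is attained at a subgradient. -/
lemma IsHamiltonian.exists_le_inner_sub_lagrangian {N : ℕ} {H : Space N → Space N → ℝ}
    (hH : IsHamiltonian H) (x p₀ : Space N) :
    ∃ q : Space N, H x p₀ ≤ ⟪p₀, q⟫ - lagrangian H x q := by
  obtain ⟨q, hq⟩ := exists_subgradient (hH.convex x) p₀
  refine ⟨q, ?_⟩
  have : lagrangian H x q ≤ ⟪p₀, q⟫ - H x p₀ := by
    refine ciSup_le fun p => ?_
    have := hq p
    rw [inner_sub_left] at this
    linarith
  linarith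

/-- The Lagrangian is upper semicontinuous in the position. -/
lemma IsHamiltonian.eventually_lagrangian_le {N : ℕ} {H : Space N → Space N → ℝ}
    (hH : IsHamiltonian H) (x q : Space N) {ε : ℝ} (hε : 0 < ε) :
    ∀ᶠ y in 𝓝 x, lagrangian H y q ≤ lagrangian H x q + ε := by
  obtain ⟨R, hR0, hR⟩ := hH.exists_radius q (lagrangian H x q)
  obtain ⟨δ, hδ, hunif⟩ :=
    Metric.uniformContinuousOn_iff.1 (hH.uniformContinuousOn R hR0) ε hε
  filter_upwards [Metric.ball_mem_nhds x hδ] with y hy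
  refine ciSup_le fun p => ?_
  rcases lt_or_ge ‖p‖ R with h | h
  · have h1 := hunif (y, p) (by simpa using h) (x, p) (by simpa using h)
      (by simpa [Prod.dist_eq, hδ] using hy)
    rw [Real.dist_eq] at h1
    have h2 : ⟪p, q⟫ - H x p ≤ lagrangian H x q := le_ciSup (hH.bddAbove x q) p
    have h3 := (abs_lt.1 h1).1
    simp only at h3
    linarith
  · linarith [hR y p h]

/-! ### The extended integral -/

/-- No measurability is needed here, since the lower integral is monotone on all functions. -/
lemma extIntegral_mono_ae {α : Type*} [MeasurableSpace α] {μ : Measure α} {f g : α → EReal}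
    (h : ∀ᵐ a ∂μ, f a ≤ g a) : extIntegral μ f ≤ extIntegral μ g := by
  refine EReal.sub_le_sub ?_ ?_
  · exact_mod_cast lintegral_mono_ae (h.mono fun a ha => EReal.toENNReal_le_toENNReal ha)
  · exact_mod_cast lintegral_mono_ae
      (h.mono fun a ha => EReal.toENNReal_le_toENNReal (EReal.neg_le_neg_iff.2 ha))

lemma extIntegral_coe {α : Type*} [MeasurableSpace α] {μ : Measure α} {f : α → ℝ}
    (hf : Integrable f μ) :
    extIntegral μ (fun a => (f a : EReal)) = ((∫ a, f a ∂μ : ℝ) : EReal) := by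
  have h1 : ∫⁻ a, ENNReal.ofReal (f a) ∂μ ≠ ⊤ := hf.lintegral_lt_top.ne
  have h2 : ∫⁻ a, ENNReal.ofReal (-f a) ∂μ ≠ ⊤ := hf.neg.lintegral_lt_top.ne
  rw [integral_eq_lintegral_pos_part_sub_lintegral_neg_part hf, extIntegral, EReal.coe_sub,
    EReal.coe_ennreal_toReal h1, EReal.coe_ennreal_toReal h2]
  simp only [← EReal.coe_neg, EReal.real_coe_toENNReal]

/-! ### The upper semicontinuous envelope -/

lemma LocallyBoundedAbove.isBoundedUnder {m N : ℕ} {u : ℝ≥0 × Space N → Fin m → ℝ}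
    (hu : LocallyBoundedAbove u) (z : ℝ≥0 × Space N) (i : Fin m) :
    (𝓝 z).IsBoundedUnder (· ≤ ·) fun w => u w i := by
  obtain ⟨C, hC⟩ := hu z
  exact ⟨C, eventually_map.2 (hC.mono fun w hw => hw i)⟩

lemma isCoboundedUnder_nhds {m N : ℕ} (u : ℝ≥0 × Space N → Fin m → ℝ)
    (z : ℝ≥0 × Space N) (i : Fin m) :
    (𝓝 z).IsCoboundedUnder (· ≤ ·) fun w => u w i :=
  ⟨u z i, fun _ ha => (eventually_map.1 ha).self_of_nhds⟩

lemma LocallyBoundedAbove.eventually_lt {m N : ℕ} {u : ℝ≥0 × Space N → Fin m → ℝ}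
    (hu : LocallyBoundedAbove u) {z : ℝ≥0 × Space N} {i : Fin m} {a : ℝ}
    (ha : uscEnvelope u z i < a) : ∀ᶠ w in 𝓝 z, u w i < a :=
  eventually_lt_of_limsup_lt ha (hu.isBoundedUnder z i)

lemma frequently_lt_of_lt_uscEnvelope {m N : ℕ} {u : ℝ≥0 × Space N → Fin m → ℝ}
    {z : ℝ≥0 × Space N} {i : Fin m} {a : ℝ}
    (ha : a < uscEnvelope u z i) : ∃ᶠ w in 𝓝 z, a < u w i :=
  frequently_lt_of_lt_limsup (isCoboundedUnder_nhds u z i) ha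

lemma LocallyBoundedAbove.eventually_uscEnvelope_le {m N : ℕ} {u : ℝ≥0 × Space N → Fin m → ℝ}
    (hu : LocallyBoundedAbove u) {z : ℝ≥0 × Space N} {i : Fin m} {a : ℝ}
    (ha : uscEnvelope u z i < a) : ∀ᶠ w in 𝓝 z, uscEnvelope u w i ≤ a :=
  (hu.eventually_lt ha).eventually_nhds.mono fun w hw =>
    limsup_le_of_le (isCoboundedUnder_nhds u w i) (hw.mono fun _ h => h.le)

/-! ### The Markov chain -/

lemma measurable_eval {m : ℕ} (t : ℝ≥0) : Measurable fun ω : PathSpace m => ω t :=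
  (comap_measurable (fun ω : PathSpace m => ω t)).mono
    (le_iSup (fun t : ℝ≥0 => MeasurableSpace.comap (fun ω : PathSpace m => ω t) ⊤) t) le_top

/-- The states form a discrete space, so that right continuity means being locally constant to
the right. -/
lemma PathSpace.eventually_eq_right {m : ℕ} (ω : PathSpace m) (s : ℝ≥0) :
    ∀ᶠ r in 𝓝[≥] s, ω r = ω s :=
  (ω.2 s).1.eventually (discreteTopology_iff_singleton_mem_nhds.1 inferInstance _)

/-- The event that the path does not leave the state `i` before the time `h`. -/
def staysUntil {m : ℕ} (i : Fin m) (h : ℝ) : Set (PathSpace m) :=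
  {ω | ∀ s : ℝ≥0, (s : ℝ) < h → ω s = i}

/-- By right continuity it is enough to look at the times of a countable dense set. -/
lemma measurableSet_staysUntil {m : ℕ} (i : Fin m) (h : ℝ) :
    MeasurableSet (staysUntil i h) := by
  obtain ⟨D, hDc, hD⟩ := TopologicalSpace.exists_countable_dense ℝ≥0
  have heq : staysUntil i h =
      ⋂ s ∈ D, {ω : PathSpace m | (s : ℝ) < h → ω s = i} := by
    ext ω
    simp only [staysUntil, mem_ofPred_eq, mem_iInter]
    refine ⟨fun H s _ => H s, fun H s hs => ?_⟩
    have hright : ∀ᶠ r in 𝓝[>] s, ω r = ω s :=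
      nhdsWithin_mono s Ioi_subset_Ici_self (ω.eventually_eq_right s)
    have hlt : ∀ᶠ r : ℝ≥0 in 𝓝[>] s, (r : ℝ) < h :=
      nhdsWithin_le_nhds ((NNReal.continuous_coe.tendsto s).eventually (gt_mem_nhds hs))
    obtain ⟨U, hU, hsub⟩ := mem_nhdsGT_iff_exists_Ioo_subset.1 (hright.and hlt)
    obtain ⟨r, hrD, hr⟩ := hD.exists_mem_open isOpen_Ioo (nonempty_Ioo.2 hU)
    have := hsub hr
    rw [← this.1]
    exact H r hrD this.2
  rw [heq]
  refine MeasurableSet.biInter hDc fun s _ => ?_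
  by_cases hs : (s : ℝ) < h
  · simp only [hs, true_imp_iff]
    exact measurable_eval s (measurableSet_singleton i)
  · simp [hs]

lemma staysUntil_antitone {m : ℕ} (i : Fin m) : Antitone (staysUntil i) :=
  fun _ _ hab _ hω s hs => hω s (hs.trans_le hab)

lemma isProbabilityMeasure_condStart {m : ℕ} {P : Measure (PathSpace m)} [IsProbabilityMeasure P]
    {i : Fin m} (hi : P (startsAt i) ≠ 0) : IsProbabilityMeasure (condStart P i) :=
  ProbabilityTheory.cond_isProbabilityMeasure hi

lemma condStart_startsAt {m : ℕ} {P : Measure (PathSpace m)} [IsProbabilityMeasure P]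
    {i : Fin m} (hi : P (startsAt i) ≠ 0) : condStart P i (startsAt i) = 1 := by
  have hmeas : MeasurableSet (startsAt (m := m) i) := measurable_eval 0 (measurableSet_singleton i)
  rw [condStart, ProbabilityTheory.cond_apply hmeas, inter_self]
  exact ENNReal.inv_mul_cancel hi (measure_ne_top _ _)

/-- A path that starts at `i` stays there for a positive time. -/
lemma tendsto_condStart_staysUntil {m : ℕ} {P : Measure (PathSpace m)} [IsProbabilityMeasure P]
    {i : Fin m} (hi : P (startsAt i) ≠ 0) :
    Tendsto (fun h : ℝ => (condStart P i).real (staysUntil i h)) (𝓝[>] 0) (𝓝 1) := by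
  have := isProbabilityMeasure_condStart hi
  have hseq : Tendsto (fun n : ℕ => condStart P i (staysUntil i (1 / ((n : ℝ) + 1)))) atTop
      (𝓝 (condStart P i (⋃ n : ℕ, staysUntil i (1 / ((n : ℝ) + 1))))) :=
    tendsto_measure_iUnion_atTop fun a b hab =>
      staysUntil_antitone i (one_div_le_one_div_of_le (by positivity) (by gcongr))
  have hone : condStart P i (⋃ n : ℕ, staysUntil i (1 / ((n : ℝ) + 1))) = 1 := by
    refine le_antisymm prob_le_one ?_
    rw [← condStart_startsAt hi]
    refine measure_mono fun ω (hω : ω 0 = i) => ?_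
    obtain ⟨a, ha, hsub⟩ := mem_nhdsGE_iff_exists_Ico_subset.1 (ω.eventually_eq_right 0)
    obtain ⟨n, hn⟩ := exists_nat_one_div_lt (NNReal.coe_pos.2 ha)
    refine mem_iUnion.2 ⟨n, fun s hs => ?_⟩
    rw [← hω]
    exact hsub ⟨zero_le, NNReal.coe_lt_coe.1 (hs.trans hn)⟩
  rw [hone] at hseq
  have hseq' : Tendsto (fun n : ℕ => (condStart P i).real (staysUntil i (1 / ((n : ℝ) + 1)))) atTop
      (𝓝 1) :=
    (ENNReal.tendsto_toReal ENNReal.one_ne_top).comp hseq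
  refine tendsto_order.2 ⟨fun a ha => ?_, fun a ha =>
    Eventually.of_forall fun h => measureReal_le_one.trans_lt ha⟩
  obtain ⟨n, hn⟩ := (hseq'.eventually (lt_mem_nhds ha)).exists
  filter_upwards [Ioo_mem_nhdsGT (show (0 : ℝ) < 1 / ((n : ℝ) + 1) by positivity)] with h hh
  exact hn.trans_le (measureReal_mono (staysUntil_antitone i hh.2.le))

/-- The transition probability from `i` to `j` in time `h`.  The positive part only serves to
match the real number `(e^{-hB})_{ij}` with an extended nonnegative one. -/
noncomputable def transitionProb {m : ℕ} (B : Matrix (Fin m) (Fin m) ℝ) (i j : Fin m)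
    (h : ℝ) : ℝ :=
  max (NormedSpace.exp (-(h • B)) i j) 0

lemma IsMarkovChain.condStart_real_eq {m : ℕ} {B : Matrix (Fin m) (Fin m) ℝ}
    {P : Measure (PathSpace m)} (hP : IsMarkovChain B P) {i : Fin m} (hi : P (startsAt i) ≠ 0)
    (j : Fin m) {h : ℝ≥0} (hh : 0 < h) :
    (condStart P i).real {ω | ω h = j} = transitionProb B i j h := by
  have hset : {ω : PathSpace m | ∀ k : Fin 1, ω ((![0, h] : Fin 2 → ℝ≥0) k.castSucc)
      = (![i, j] : Fin 2 → Fin m) k.castSucc} = startsAt i := by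
    ext ω; simp [startsAt]
  have hmono : StrictMono (![0, h] : Fin 2 → ℝ≥0) := by
    refine Fin.strictMono_iff_lt_succ.2 fun k => ?_
    fin_cases k
    simpa using hh
  have := hP 0 ![0, h] ![i, j] hmono (by rw [hset]; exact hi)
  rw [hset] at this
  simp only [Fin.isValue, Nat.reduceAdd, Fin.last_zero, Fin.castSucc_zero, Matrix.cons_val_zero,
    Fin.reduceLast, Matrix.cons_val_one, NNReal.coe_zero, sub_zero] at this
  rw [Measure.real, condStart, this, transitionProb, ENNReal.toReal_ofReal']

lemma integral_comp_eval {m : ℕ} {μ : Measure (PathSpace m)} [IsFiniteMeasure μ]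
    (h : ℝ≥0) (f : Fin m → ℝ) :
    ∫ ω, f (ω h) ∂μ = ∑ j, μ.real {ω | ω h = j} * f j := by
  have hmeas := measurable_eval (m := m) h
  rw [← integral_map (φ := fun ω : PathSpace m => ω h) hmeas.aemeasurable
    (measurable_of_countable f).aestronglyMeasurable,
    integral_fintype .of_finite]
  refine Finset.sum_congr rfl fun j _ => ?_
  rw [map_measureReal_apply hmeas (measurableSet_singleton j)]
  rfl

open scoped Matrix.Norms.Operator in
lemma hasDerivAt_exp_neg_smul_apply {m : ℕ} (B : Matrix (Fin m) (Fin m) ℝ) (i j : Fin m) :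
    HasDerivAt (fun h : ℝ => NormedSpace.exp (-(h • B)) i j) (-B i j) 0 := by
  have h1 := hasDerivAt_exp_smul_const (𝕂 := ℝ) (-B) (0 : ℝ)
  simp only [zero_smul, smul_neg] at h1
  have h2 := (hasDerivAt_pi.1 (hasDerivAt_pi.1 h1 i) j)
  exact h2.congr_deriv (by rw [neg_zero, NormedSpace.exp_zero, one_mul, Matrix.neg_apply])

/-- The generator of the chain is `-B`; the truncation is harmless because the
off-diagonal entries of `-B` are nonnegative. -/
lemma IsCouplingMatrix.tendsto_transitionProb {m : ℕ} {B : Matrix (Fin m) (Fin m) ℝ}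
    (hB : IsCouplingMatrix B) (i j : Fin m) :
    Tendsto (fun h : ℝ => ((1 : Matrix (Fin m) (Fin m) ℝ) i j - transitionProb B i j h) / h)
      (𝓝[>] 0) (𝓝 (B i j)) := by
  have hd := hasDerivAt_exp_neg_smul_apply B i j
  have h0 : NormedSpace.exp (-((0 : ℝ) • B)) i j = (1 : Matrix (Fin m) (Fin m) ℝ) i j := by simp
  have hs : Tendsto (fun h : ℝ => (NormedSpace.exp (-(h • B)) i j
      - (1 : Matrix (Fin m) (Fin m) ℝ) i j) / h) (𝓝[>] 0) (𝓝 (-B i j)) := by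
    have := hd.tendsto_slope_zero_right
    simpa [div_eq_inv_mul] using this
  by_cases hij : j = i
  · subst hij
    have hpos : ∀ᶠ h : ℝ in 𝓝[>] 0, 0 < NormedSpace.exp (-(h • B)) j j := by
      refine nhdsWithin_le_nhds (hd.continuousAt.eventually (lt_mem_nhds ?_))
      simp
    have := hs.neg
    rw [neg_neg] at this
    refine this.congr' ?_
    filter_upwards [hpos] with h hh
    rw [transitionProb, max_eq_left hh.le]
    ring
  · have h1 : (1 : Matrix (Fin m) (Fin m) ℝ) i j = 0 := Matrix.one_apply_ne' hij
    rw [h1] at hs ⊢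
    have := (hs.max (tendsto_const_nhds (x := (0 : ℝ)))).neg
    rw [max_eq_left (by linarith [hB.offDiag_nonpos i j hij]), neg_neg] at this
    refine this.congr' ?_
    filter_upwards [self_mem_nhdsWithin] with h (hh : 0 < h)
    rw [transitionProb, sub_zero, zero_sub, neg_div, ← max_div_div_right hh.le, zero_div]

/-! ### The action along a curve -/

lemma pathAction_le {m N : ℕ} {H : Fin m → Space N → Space N → ℝ} {γ : ℝ → Space N} {h : ℝ≥0}
    {ω : PathSpace m} {C : ℝ}
    (hC : ∀ s ∈ Ico (0 : ℝ) h, lagrangian (H (ω s.toNNReal)) (γ s) (-deriv γ s) ≤ C) :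
    pathAction H γ h ω ≤ ((h * C : ℝ) : EReal) := by
  have hae : ∀ᵐ s ∂volume.restrict (Icc (0 : ℝ) h),
      ((lagrangian (H (ω s.toNNReal)) (γ s) (-deriv γ s) : ℝ) : EReal) ≤ (C : EReal) := by
    rw [← Measure.restrict_congr_set Ico_ae_eq_Icc]
    exact (ae_restrict_mem measurableSet_Ico).mono fun s hs => EReal.coe_le_coe_iff.2 (hC s hs)
  refine (extIntegral_mono_ae hae).trans_eq ?_
  rw [extIntegral_coe (integrable_const C)]
  simp

/-- The bound `K` on the Lagrangian of the initial state applies on the event that the chain does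
not jump, the cruder bound `M` on its complement.  The bounding function takes two values and is
measurable, so that no measurability of the action in `ω` has to be known. -/
lemma extIntegral_pathAction_le {m N : ℕ} {H : Fin m → Space N → Space N → ℝ}
    {μ : Measure (PathSpace m)} [IsProbabilityMeasure μ] {γ : ℝ → Space N} {h : ℝ≥0} {i : Fin m}
    {K M : ℝ} (hK : ∀ s ∈ Ico (0 : ℝ) h, lagrangian (H i) (γ s) (-deriv γ s) ≤ K)
    (hM : ∀ s ∈ Ico (0 : ℝ) h, ∀ j, lagrangian (H j) (γ s) (-deriv γ s) ≤ M) :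
    extIntegral μ (pathAction H γ h) ≤
      ((h * (K * μ.real (staysUntil i h) + M * (1 - μ.real (staysUntil i h))) : ℝ) : EReal) := by
  have hS := measurableSet_staysUntil (m := m) i h
  set S := staysUntil (m := m) i h
  have hle : ∀ ω, pathAction H γ h ω ≤
      ((S.indicator (fun _ => h * K) ω + Sᶜ.indicator (fun _ => h * M) ω : ℝ) : EReal) := by
    intro ω
    by_cases hω : ω ∈ S
    · rw [indicator_of_mem hω, indicator_of_notMem (by simpa using hω), add_zero]
      refine pathAction_le fun s hs => ?_
      rw [hω s.toNNReal (by rw [Real.coe_toNNReal s hs.1]; exact hs.2)]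
      exact hK s hs
    · rw [indicator_of_notMem hω, indicator_of_mem (by simpa using hω), zero_add]
      exact pathAction_le fun s hs => hM s hs _
  have hi1 : Integrable (S.indicator fun _ => (h * K : ℝ)) μ := (integrable_const _).indicator hS
  have hi2 : Integrable (Sᶜ.indicator fun _ => (h * M : ℝ)) μ :=
    (integrable_const _).indicator hS.compl
  refine (extIntegral_mono_ae (ae_of_all _ hle)).trans_eq ?_
  refine (extIntegral_coe (hi1.add hi2)).trans ?_
  rw [integral_add' hi1 hi2, integral_indicator_const _ hS,
    integral_indicator_const _ hS.compl, probReal_compl_eq_one_sub hS]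
  congr 1
  simp only [smul_eq_mul]
  ring

lemma isCurve_line {N : ℕ} (y q : Space N) : IsCurve fun s : ℝ => y - s • q := by
  intro T _
  refine LipschitzOnWith.absolutelyContinuousOnInterval (K := ‖q‖₊) ?_
  refine (LipschitzWith.of_dist_le_mul fun a b => ?_).lipschitzOnWith
  rw [dist_sub_left, dist_eq_norm, ← sub_smul, norm_smul, coe_nnnorm, mul_comm, Real.dist_eq,
    Real.norm_eq_abs]

lemma deriv_line {N : ℕ} (y q : Space N) (s : ℝ) : deriv (fun s : ℝ => y - s • q) s = -q := by
  have := ((hasDerivAt_id s).smul_const q).const_sub y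
  simpa using this.deriv

/-! ### The sub-optimality principle for the envelope -/

/-- The sub-optimality principle along short straight lines passes to the upper semicontinuous
envelope: apply it at points `w → z` along which `u_i(w)` tends to `u_i^*(z)`. -/
lemma SubOptimalityPrinciple.uscEnvelope_sub_sum_le {m N : ℕ}
    {H : Fin m → Space N → Space N → ℝ} (hH : ∀ i, IsHamiltonian (H i))
    {B : Matrix (Fin m) (Fin m) ℝ} {P : Measure (PathSpace m)} [IsProbabilityMeasure P]
    (hP : IsMarkovChain B P) {u : ℝ≥0 × Space N → Fin m → ℝ} (hu : LocallyBoundedAbove u)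
    (hsub : SubOptimalityPrinciple H P u) {i : Fin m} (hi : P (startsAt i) ≠ 0)
    {z : ℝ≥0 × Space N} (hz : 0 < z.1) (q : Space N) :
    ∃ M : ℝ, ∀ η > 0, ∀ᶠ h : ℝ in 𝓝[>] 0,
      uscEnvelope u z i -
          ∑ j, transitionProb B i j h * uscEnvelope u (z.1 - h.toNNReal, z.2 - h • q) j ≤
        h * ((lagrangian (H i) z.2 q + η) * (condStart P i).real (staysUntil i h) +
          M * (1 - (condStart P i).real (staysUntil i h))) := by
  have := isProbabilityMeasure_condStart hi
  refine ⟨∑ j, |lagrangian (H j) z.2 q| + 1, fun η hη => ?_⟩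
  set M := ∑ j, |lagrangian (H j) z.2 q| + 1
  have hnear : ∀ᶠ y in 𝓝 z.2, lagrangian (H i) y q ≤ lagrangian (H i) z.2 q + η ∧
      ∀ j, lagrangian (H j) y q ≤ M := by
    refine ((hH i).eventually_lagrangian_le z.2 q hη).and (eventually_all.2 fun j => ?_)
    refine ((hH j).eventually_lagrangian_le z.2 q one_pos).mono fun y hy => hy.trans ?_
    have : |lagrangian (H j) z.2 q| ≤ ∑ k, |lagrangian (H k) z.2 q| :=
      Finset.single_le_sum (f := fun k => |lagrangian (H k) z.2 q|) (fun k _ => abs_nonneg _)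
        (Finset.mem_univ j)
    linarith [le_abs_self (lagrangian (H j) z.2 q)]
  obtain ⟨δ, hδ, hball⟩ := Metric.eventually_nhds_iff.1 hnear
  have hsmall : ∀ᶠ h : ℝ in 𝓝[>] 0, h * ‖q‖ < δ / 2 := by
    have : Tendsto (fun h : ℝ => h * ‖q‖) (𝓝 0) (𝓝 (0 * ‖q‖)) :=
      Continuous.tendsto (by fun_prop) 0
    rw [zero_mul] at this
    exact nhdsWithin_le_nhds (this.eventually (gt_mem_nhds (by positivity)))
  filter_upwards [hsmall, Ioo_mem_nhdsGT (NNReal.coe_pos.2 hz)] with h hhδ hh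
  lift h to ℝ≥0 using hh.1.le
  have hh0 : 0 < h := NNReal.coe_pos.1 hh.1
  have hhz : h < z.1 := NNReal.coe_lt_coe.1 hh.2
  rw [Real.toNNReal_coe]
  set V := fun j => uscEnvelope u (z.1 - h, z.2 - (h : ℝ) • q) j
  have hw0 : ∀ j, 0 ≤ transitionProb B i j h := fun j => le_max_right _ _
  set W := ∑ j, transitionProb B i j h with hW
  have hW0 : 0 ≤ W := Finset.sum_nonneg fun j _ => hw0 j
  refine le_of_forall_pos_le_add fun e he => ?_
  -- The error `ε` is made once in `u_i^*(z)` and once with each of the weights, of total mass `W`.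
  set ε := e / (1 + W) with hε_def
  have hε : 0 < ε := by positivity
  have hshift : Tendsto (fun w : ℝ≥0 × Space N => (w.1 - h, w.2 - (h : ℝ) • q)) (𝓝 z)
      (𝓝 (z.1 - h, z.2 - (h : ℝ) • q)) :=
    Continuous.tendsto (by fun_prop) z
  have hV : ∀ᶠ w : ℝ≥0 × Space N in 𝓝 z, ∀ j, u (w.1 - h, w.2 - (h : ℝ) • q) j < V j + ε :=
    eventually_all.2 fun j => hshift.eventually (hu.eventually_lt (lt_add_of_pos_right _ hε))
  have hclose : ∀ᶠ w : ℝ≥0 × Space N in 𝓝 z, h < w.1 ∧ dist w.2 z.2 < δ / 2 :=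
    ((continuous_fst.tendsto z).eventually (lt_mem_nhds hhz)).and
      ((continuous_snd.tendsto z).eventually (Metric.ball_mem_nhds _ (half_pos hδ)))
  obtain ⟨w, hwU, hwV, hwh, hwδ⟩ :=
    ((frequently_lt_of_lt_uscEnvelope (sub_lt_self (uscEnvelope u z i) hε)).and_eventually
      (hV.and hclose)).exists
  have hline : ∀ s ∈ Ico (0 : ℝ) h, dist (w.2 - s • q) z.2 < δ := by
    intro s hs
    calc dist (w.2 - s • q) z.2 ≤ dist (w.2 - s • q) w.2 + dist w.2 z.2 := dist_triangle _ _ _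
      _ = s * ‖q‖ + dist w.2 z.2 := by
        rw [dist_eq_norm, sub_sub_cancel_left, norm_neg, norm_smul, Real.norm_of_nonneg hs.1]
      _ ≤ h * ‖q‖ + dist w.2 z.2 := by gcongr; exact hs.2.le
      _ < δ := by linarith
  have hopt := (hsub (w.1 - h) h i (fun s => w.2 - s • q) (isCurve_line _ _)).trans
    (extIntegral_pathAction_le (i := i) (K := lagrangian (H i) z.2 q + η) (M := M)
      (fun s hs => by rw [deriv_line, neg_neg]; exact (hball (hline s hs)).1)
      (fun s hs j => by rw [deriv_line, neg_neg]; exact (hball (hline s hs)).2 j))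
  rw [EReal.coe_le_coe_iff, tsub_add_cancel_of_le hwh.le, zero_smul, sub_zero,
    integral_comp_eval h fun j => u (w.1 - h, w.2 - (h : ℝ) • q) j] at hopt
  simp only [hP.condStart_real_eq hi _ hh0] at hopt
  have hsum : ∑ j, transitionProb B i j h * u (w.1 - h, w.2 - (h : ℝ) • q) j ≤
      ∑ j, transitionProb B i j h * V j + W * ε := by
    rw [hW, Finset.sum_mul, ← Finset.sum_add_distrib]
    refine Finset.sum_le_sum fun j _ => ?_
    rw [← mul_add]
    exact mul_le_mul_of_nonneg_left (hwV j).le (hw0 j)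
  have hεe : ε + W * ε = e := by
    rw [hε_def]; field_simp
  linarith

end HJSystem

/-! ### The subsolution property -/

theorem mainTheorem4 {m N : ℕ}
    (H : Fin m → HJSystem.Space N → HJSystem.Space N → ℝ)
    (hH : ∀ i, HJSystem.IsHamiltonian (H i))
    (B : Matrix (Fin m) (Fin m) ℝ) (hB : HJSystem.IsCouplingMatrix B)
    (P : MeasureTheory.Measure (HJSystem.PathSpace m)) [MeasureTheory.IsProbabilityMeasure P]
    (hP : HJSystem.IsMarkovChain B P)
    (hP_pos : ∀ i, P (HJSystem.startsAt i) ≠ 0)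
    (u : ℝ≥0 × HJSystem.Space N → Fin m → ℝ)
    (hu_bdd : HJSystem.LocallyBoundedAbove u)
    (hu_sub : HJSystem.SubOptimalityPrinciple H P u) :
    HJSystem.IsViscositySubsolution H B u := by
  refine ⟨fun z _ => hu_bdd z, ?_⟩
  rintro z hz i ⟨pt, px⟩ ⟨φ, hφ, hmax, hφ'⟩
  simp only at hmax hφ' ⊢
  obtain ⟨q, hq⟩ := (hH i).exists_le_inner_sub_lagrangian z.2 px
  obtain ⟨M, hM⟩ := hu_sub.uscEnvelope_sub_sum_le hH hP hu_bdd (hP_pos i) hz q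
  set U := fun j => HJSystem.uscEnvelope u z j with hU
  set L := HJSystem.lagrangian (H i) z.2 q
  -- The increment of the test function along the line `h ↦ (t - h, x - h q)`.
  set g : ℝ → ℝ := fun h => φ ((z.1 : ℝ) - h, z.2 - h • q) - φ ((z.1 : ℝ), z.2) with hg
  have hg' : Tendsto (fun h => g h / h) (𝓝[>] 0) (𝓝 (-(pt + ⟪px, q⟫))) := by
    have hl : HasDerivAt (fun h : ℝ => ((z.1 : ℝ) - h, z.2 - h • q)) (-1, -q) 0 := by
      refine HasDerivAt.prodMk ?_ ?_
      · simpa using (hasDerivAt_id (0 : ℝ)).const_sub (z.1 : ℝ)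
      · simpa using ((hasDerivAt_id (0 : ℝ)).smul_const q).const_sub z.2
    have hφd : HasFDerivAt φ (fderiv ℝ φ ((z.1 : ℝ), z.2)) ((z.1 : ℝ) - 0, z.2 - (0 : ℝ) • q) := by
      simpa using (hφ.differentiableAt one_ne_zero).hasFDerivAt
    have hc := (hφd.comp_hasDerivAt (0 : ℝ) hl).tendsto_slope_zero_right
    have hval : fderiv ℝ φ ((z.1 : ℝ), z.2) (-1, -q) = -(pt + ⟪px, q⟫) := by
      rw [hφ', inner_neg_right]; ring
    rw [hval] at hc
    simpa [hg, div_eq_inv_mul] using hc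
  have hshift : Tendsto (fun h : ℝ => (z.1 - h.toNNReal, z.2 - h • q)) (𝓝[>] 0) (𝓝 z) := by
    have : Continuous fun h : ℝ => (z.1 - h.toNNReal, z.2 - h • q) := by fun_prop
    simpa using (this.tendsto 0).mono_left nhdsWithin_le_nhds
  have htest : ∀ᶠ h : ℝ in 𝓝[>] 0,
      HJSystem.uscEnvelope u (z.1 - h.toNNReal, z.2 - h • q) i ≤ U i + g h := by
    filter_upwards [hshift.eventually hmax, Ioo_mem_nhdsGT (NNReal.coe_pos.2 hz)] with h hh hhz
    have hle : h.toNNReal ≤ z.1 := Real.toNNReal_le_iff_le_coe.2 hhz.2.le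
    simp only [NNReal.coe_sub hle, Real.coe_toNNReal h hhz.1.le] at hh
    simp only [hg, hU]
    linarith
  clear_value g
  have hw := fun j => hB.tendsto_transitionProb i j
  -- The difference quotient of the weight converges, so the weight itself tends to `1`.
  have hw1 : Tendsto (fun h => HJSystem.transitionProb B i i h) (𝓝[>] 0) (𝓝 1) := by
    have h1 : Tendsto (fun h : ℝ => 1 - (((1 : Matrix (Fin m) (Fin m) ℝ) i i
        - HJSystem.transitionProb B i i h) / h) * h) (𝓝[>] 0) (𝓝 (1 - B i i * 0)) :=
      tendsto_const_nhds.sub ((hw i).mul (tendsto_id.mono_left nhdsWithin_le_nhds))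
    rw [mul_zero, sub_zero] at h1
    refine h1.congr' ?_
    filter_upwards [self_mem_nhdsWithin] with h (hh : 0 < h)
    rw [div_mul_cancel₀ _ hh.ne', Matrix.one_apply_eq]
    ring
  have hπ := HJSystem.tendsto_condStart_staysUntil (hP_pos i)
  -- Divide the principle by `h` and let `h → 0`: the test function controls the `i`-th component,
  -- upper semicontinuity (with an error `η`) the other ones, whose weights are of order `h`.
  have hmain : ∀ η > 0, (∑ j, B i j * U j) + (pt + ⟪px, q⟫) ≤
      L + η + η * ∑ j ∈ Finset.univ.erase i, -B i j := by
    intro η hη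
    have husc : ∀ᶠ h : ℝ in 𝓝[>] 0, ∀ j,
        HJSystem.uscEnvelope u (z.1 - h.toNNReal, z.2 - h • q) j ≤ U j + η :=
      eventually_all.2 fun j => hshift.eventually
        (hu_bdd.eventually_uscEnvelope_le (lt_add_of_pos_right _ hη))
    have hlhs : Tendsto (fun h : ℝ => (∑ j, ((1 : Matrix (Fin m) (Fin m) ℝ) i j
          - HJSystem.transitionProb B i j h) / h * U j)
          - HJSystem.transitionProb B i i h * (g h / h)) (𝓝[>] 0)
        (𝓝 ((∑ j, B i j * U j) - 1 * -(pt + ⟪px, q⟫))) :=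
      (tendsto_finsetSum _ fun j _ => (hw j).mul_const _).sub (hw1.mul hg')
    have hrhs : Tendsto (fun h : ℝ => (L + η) * (HJSystem.condStart P i).real
          (HJSystem.staysUntil i h)
          + M * (1 - (HJSystem.condStart P i).real (HJSystem.staysUntil i h))
          + η * ∑ j ∈ Finset.univ.erase i, -(((1 : Matrix (Fin m) (Fin m) ℝ) i j
            - HJSystem.transitionProb B i j h) / h)) (𝓝[>] 0)
        (𝓝 ((L + η) * 1 + M * (1 - 1) + η * ∑ j ∈ Finset.univ.erase i, -B i j)) :=
      ((hπ.const_mul _).add ((hπ.const_sub 1).const_mul M)).add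
        ((tendsto_finsetSum _ fun j _ => (hw j).neg).const_mul η)
    have hle := le_of_tendsto_of_tendsto hlhs hrhs ?_
    · linarith
    filter_upwards [husc, htest, hM η hη, self_mem_nhdsWithin] with h h1 h2 h3 (hh : 0 < h)
    have hw0 : ∀ j, 0 ≤ HJSystem.transitionProb B i j h := fun j => le_max_right _ _
    have hsum : ∑ j, HJSystem.transitionProb B i j h
          * HJSystem.uscEnvelope u (z.1 - h.toNNReal, z.2 - h • q) j ≤
        (∑ j, HJSystem.transitionProb B i j h * U j) + HJSystem.transitionProb B i i h * g h
          + η * ∑ j ∈ Finset.univ.erase i, HJSystem.transitionProb B i j h := by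
      rw [← Finset.add_sum_erase _ _ (Finset.mem_univ i),
        ← Finset.add_sum_erase _ (fun j => HJSystem.transitionProb B i j h * U j)
          (Finset.mem_univ i), Finset.mul_sum]
      have hi := mul_le_mul_of_nonneg_left h2 (hw0 i)
      have hj := Finset.sum_le_sum fun j (_ : j ∈ Finset.univ.erase i) =>
        mul_le_mul_of_nonneg_left (h1 j) (hw0 j)
      simp only [mul_add, Finset.sum_add_distrib] at hi hj
      simp only [mul_comm η]
      linarith
    have hone : ∑ j, (1 : Matrix (Fin m) (Fin m) ℝ) i j * U j = U i := by
      simp [Matrix.one_apply]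
    have herase : ∑ j ∈ Finset.univ.erase i, -(((1 : Matrix (Fin m) (Fin m) ℝ) i j
        - HJSystem.transitionProb B i j h) / h)
        = (∑ j ∈ Finset.univ.erase i, HJSystem.transitionProb B i j h) / h := by
      rw [Finset.sum_div]
      refine Finset.sum_congr rfl fun j hj => ?_
      rw [Matrix.one_apply_ne' (Finset.ne_of_mem_erase hj)]
      ring
    have hlhs_eq : (∑ j, ((1 : Matrix (Fin m) (Fin m) ℝ) i j
          - HJSystem.transitionProb B i j h) / h * U j)
          - HJSystem.transitionProb B i i h * (g h / h)
        = (U i - ∑ j, HJSystem.transitionProb B i j h * U j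
          - HJSystem.transitionProb B i i h * g h) / h := by
      rw [← hone, ← Finset.sum_sub_distrib, sub_div, Finset.sum_div, mul_div_assoc]
      congr 1
      exact Finset.sum_congr rfl fun j _ => by ring
    rw [herase, hlhs_eq, div_le_iff₀ hh, add_mul, mul_assoc η, div_mul_cancel₀ _ hh.ne']
    linarith
  have hlim : Tendsto (fun η : ℝ => L + η + η * ∑ j ∈ Finset.univ.erase i, -B i j) (𝓝[>] 0)
      (𝓝 (L + 0 + 0 * ∑ j ∈ Finset.univ.erase i, -B i j)) :=
    (Continuous.tendsto (by fun_prop) 0).mono_left nhdsWithin_le_nhds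
  have hfinal := ge_of_tendsto hlim (eventually_nhdsWithin_of_forall hmain)
  have hmul : B.mulVec (HJSystem.uscEnvelope u z) i = ∑ j, B i j * U j := rfl
  rw [hmul]
  linarith
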